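/- Let $\mathcal D=(V,E)$ be a directed acyclic graph with $V=\{1,\dots,d\}$, let $C=(c_{ij})\in\mathbb R_+^{d\times d}$ with $c_{ij}=0$ unless $j\to i$ is an edge, let $s_{ii}>0$ for $i\in V$, $S=\mathrm{diag}(s_{11},\dots,s_{dd})$, and let the random vector $X$ be given by the linear structural equations \[X_i=\sum_{j\in\mathrm{pa}(i)}c_{ij}X_j+s_{ii}Z_i,\qquad i\in V,\] where $Z$ is a random vector in $\mathbb R_+^d$. Let $\|\cdot\|$ be the Euclidean norm, $\Theta_+^{d-1}=\{\omega\in\mathbb R_+^d:\|\omega\|=1\}$, and for $\alpha>0$ let $\nu_\alpha$ be the measure on $(0,\infty]$ given by $d\nu_\alpha(x)=\alpha x^{-\alpha-1}\,dx$. A finite measure $H$ on $\Theta_+^{d-1}$ is called the angular measure of a random vector $Y\in\mathbb R_+^d$ with index $\alpha$ and normalising sequence $b_n\to\infty$ if, as $n\to\infty$, \[n\,\mathbb P\big((\|Y\|/b_n,\;Y/\|Y\|)\in\cdot\,\big)\to\nu_\alpha\times H\quad\text{vaguely on }(0,\infty]\times\Theta_+^{d-1},\] and $Y\in\mathrm{RV}_+^d(\alpha)$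 means that this holds for some sequence $b_n\to\infty$ and some $H\neq0$. Assume that $Z\in\mathrm{RV}_+^d(2)$ has independent components that are standardised, that is, $n\,\mathbb P(n^{-1/2}Z_i>z)\to z^{-2}$ as $n\to\infty$ for all $z>0$ and $i\in V$. Then $X=AZ$ with $A=(a_{ij})=(I-C)^{-1}S\in\mathbb R_+^{d\times d}$, $X\in\mathrm{RV}_+^d(2)$, and $X$ has exactly one angular measure $H_X$ with index $2$ and normalising sequence $b_n=n^{1/2}$. Write $a_k$ for the $k$-th column of $A$, and put \[\sigma_{ij}^2=\int_{\Theta_+^{d-1}}\omega_i\omega_j\,dH_X(\omega),\qquad \sigma_i=(\sigma_{ii}^2)^{1/2}.\] Then: (i) the support of $H_X$ is the set of normalised columns $\{a_k/\|a_k\|:k\in V\}$; (ii) $\sigma_{ij}^2=(AA^\top)_{ij}=\sum_{k=1}^d a_{ik}a_{jk}$ for all $i,j\in V$; (iii) the squared scaling of the margin $X_i$ is $\sigma_i^2=\sum_{k=1}^d a_{ik}^2$ for all $i\in V$. -/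

import Mathlib

open MeasureTheory ProbabilityTheory Filter Topology
open scoped ENNReal

noncomputable section

/-- A non-negative linear structural equation model on `d` nodes: a directed acyclic graph
(`graph.Adj j i` is the edge `j → i`), edge weights `C i j ≥ 0`, with `C i j` the weight of the
edge `j → i` and zero when there is no such edge, and innovation weights `s i > 0`. -/
structure LSEMPlus (d : ℕ) where
  graph : Digraph (Fin d)
  acyclic : ∀ i, ¬ Relation.TransGen graph.Adj i i
  C : Matrix (Fin d) (Fin d) ℝ
  C_nonneg : ∀ i j, 0 ≤ C i j
  C_eq_zero : ∀ i j, ¬ graph.Adj j i → C i j = 0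
  s : Fin d → ℝ
  s_pos : ∀ i, 0 < s i

namespace LSEMPlus

variable {d : ℕ}

open Classical in
/-- The parents of the node `i`. -/
def pa (M : LSEMPlus d) (i : Fin d) : Finset (Fin d) :=
  Finset.univ.filter fun j => M.graph.Adj j i

/-- The innovation coefficient matrix `A = (I - C)⁻¹ S`. -/
def coeffMatrix (M : LSEMPlus d) : Matrix (Fin d) (Fin d) ℝ :=
  (1 - M.C)⁻¹ * Matrix.diagonal M.s

/-- The random vector `X` follows the model `M` with innovations `Z`:
`X i = ∑ j ∈ pa i, C i j * X j + s i * Z i` for every node `i`. -/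
def IsSolution (M : LSEMPlus d) {Ω : Type*} (Z X : Ω → EuclideanSpace ℝ (Fin d)) : Prop :=
  ∀ ω i, X ω i = ∑ j ∈ M.pa i, M.C i j * X ω j + M.s i * Z ω i

end LSEMPlus

/-- The part of the Euclidean unit sphere of `ℝᵈ` in the non-negative orthant. -/
def posSphere (d : ℕ) : Set (EuclideanSpace ℝ (Fin d)) :=
  {w | (∀ i, 0 ≤ w i) ∧ ‖w‖ = 1}

/-- The half-line `(0, ∞]`; its compact subsets are bounded away from `0`. -/
abbrev PosRadii : Type := Set.Ioi (0 : ℝ≥0∞)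

/-- Vague convergence: convergence of the integrals of all compactly supported continuous
functions. -/
def VagueTendsto {E : Type*} [TopologicalSpace E] [MeasurableSpace E]
    (μ : ℕ → Measure E) (ν : Measure E) : Prop :=
  ∀ f : CompactlySupportedContinuousMap E ℝ,
    Tendsto (fun n => ∫ x, f x ∂(μ n)) atTop (𝓝 (∫ x, f x ∂ν))

/-- The measure `ν_α` on `(0, ∞]` with density `α x ^ (-α - 1)` on `(0, ∞)` and no mass
at `∞`. -/
def powerMeasure (α : ℝ) : Measure PosRadii :=
  Measure.comap Subtype.val
    (Measure.map ENNReal.ofReal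
      ((volume.restrict (Set.Ioi (0 : ℝ))).withDensity
        fun x => ENNReal.ofReal (α * x ^ (-α - 1))))

/-- The measure `P ((R / b, X / R) ∈ ·)`, `R = ‖X‖`, on `(0, ∞] × posSphere d`. The event
`X = 0`, where the angle is undefined, is sent to `(0, 0)`, outside this space, and so does
not contribute. -/
def polarLaw {d : ℕ} {Ω : Type*} [MeasurableSpace Ω] (P : Measure Ω)
    (X : Ω → EuclideanSpace ℝ (Fin d)) (b : ℝ) : Measure (PosRadii × posSphere d) :=
  Measure.comap (Prod.map Subtype.val Subtype.val)
    (P.map fun ω => (ENNReal.ofReal (‖X ω‖ / b), ‖X ω‖⁻¹ • X ω))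

/-- `H` is the angular measure (for the Euclidean norm) of the random vector `X`, with index
`α` and normalising sequence `b`: `H` is finite, `b n → ∞`, and `n P ((R / b n, X / R) ∈ ·)`
converges vaguely to `ν_α × H` on `(0, ∞] × posSphere d`. -/
structure IsAngularMeasure {d : ℕ} {Ω : Type*} [MeasurableSpace Ω] (P : Measure Ω)
    (X : Ω → EuclideanSpace ℝ (Fin d)) (α : ℝ) (b : ℕ → ℝ) (H : Measure (posSphere d)) :
    Prop where
  finite : IsFiniteMeasure H
  tendsto_atTop : Tendsto b atTop atTop
  vague : VagueTendsto (fun n : ℕ => (n : ℝ≥0∞) • polarLaw P X (b n))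
    ((powerMeasure α).prod H)

/-- `X ∈ RV₊ᵈ(α)`: the random vector `X` has non-negative components and is multivariate
regularly varying with index `α > 0`. The limit is required to be non-zero, as otherwise every
random vector would qualify, with a rapidly growing `b`. -/
def IsRegularlyVarying {d : ℕ} {Ω : Type*} [MeasurableSpace Ω] (P : Measure Ω)
    (X : Ω → EuclideanSpace ℝ (Fin d)) (α : ℝ) : Prop :=
  0 < α ∧ (∀ ω i, 0 ≤ X ω i) ∧
    ∃ (b : ℕ → ℝ) (H : Measure (posSphere d)), H ≠ 0 ∧ IsAngularMeasure P X α b H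

/-- The random variable `Y` is standardised with index `α`:
`n P (n ^ (-1 / α) Y > z) → z ^ (-α)` for all `z > 0`. -/
def IsStandardised {Ω : Type*} [MeasurableSpace Ω] (P : Measure Ω) (Y : Ω → ℝ) (α : ℝ) :
    Prop :=
  ∀ z : ℝ, 0 < z →
    Tendsto (fun n : ℕ => (n : ℝ) * P.real {ω | z < (n : ℝ) ^ (-1 / α) * Y ω}) atTop
      (𝓝 (z ^ (-α)))

/-- The extremal dependence measure `σ²_{ij} = ∫ ω_i ω_j dH(ω)`. -/
def extremalDependence {d : ℕ} (H : Measure (posSphere d)) (i j : Fin d) : ℝ :=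
  ∫ w, w.1 i * w.1 j ∂H

/-- The scaling `σ_i = (σ²_{ii})^{1/2}` of the `i`-th component. -/
def scaling {d : ℕ} (H : Measure (posSphere d)) (i : Fin d) : ℝ :=
  √(extremalDependence H i i)

/-- The `k`-th column of `A`, as a vector of Euclidean space. -/
def columnVec {d : ℕ} (A : Matrix (Fin d) (Fin d) ℝ) (k : Fin d) : EuclideanSpace ℝ (Fin d) :=
  WithLp.toLp 2 fun i => A i k

end

/-! Since two independent coordinates of `Z` are of order `n ^ (1 / α)` at the same time only with
probability `O(n⁻²)`, the measures `n P (n ^ (-1 / α) Z ∈ ·)` concentrate on the coordinate axes in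
the limit, with the measure of density `α t ^ (-α - 1)` on each of them. A non-negative matrix `A`
maps the `k`-th axis to the ray through the column `a_k`, and the homogeneity of `ν_α` turns the
dilation by `‖a_k‖` into a mass `‖a_k‖ ^ α` at the direction `a_k / ‖a_k‖`. The angular measure is
determined by the vague limit, because a Radon measure is determined by its integrals of compactly
supported continuous functions. -/

open scoped NNReal

section WeakConvergence

variable {E ι : Type*} [TopologicalSpace E] [SecondCountableTopology E] [MeasurableSpace E]
  [OpensMeasurableSpace E] {l : Filter ι} [l.IsCountablyGenerated]

lemma tendsto_integral_of_isPiSystem {S : Set (Set E)} (hS : IsPiSystem S)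
    (hmeas : ∀ s ∈ S, MeasurableSet s)
    (hnhds : ∀ u : Set E, IsOpen u → ∀ x ∈ u, ∃ s ∈ S, s ∈ 𝓝 x ∧ s ⊆ u)
    {μ : ι → Measure E} {ν : Measure E} [∀ i, IsFiniteMeasure (μ i)] [IsFiniteMeasure ν]
    (huniv : Tendsto (fun i => (μ i).real Set.univ) l (𝓝 (ν.real Set.univ)))
    (hset : ∀ s ∈ S, Tendsto (fun i => (μ i).real s) l (𝓝 (ν.real s)))
    (g : BoundedContinuousFunction E ℝ) :
    Tendsto (fun i => ∫ x, g x ∂(μ i)) l (𝓝 (∫ x, g x ∂ν)) := by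
  let m : ι → FiniteMeasure E := fun i => ⟨μ i, inferInstance⟩
  let m' : FiniteMeasure E := ⟨ν, inferInstance⟩
  have hmass : Tendsto (fun i => (m i).mass) l (𝓝 m'.mass) := NNReal.tendsto_coe.mp huniv
  suffices Tendsto m l (𝓝 m') from FiniteMeasure.tendsto_iff_forall_integral_tendsto.mp this g
  by_cases hm' : m' = 0
  · rw [hm'] at hmass ⊢
    exact FiniteMeasure.tendsto_zero_of_tendsto_zero_mass (by simpa using hmass)
  have : NeZero ν := ⟨fun h => hm' (Subtype.ext h)⟩
  have : Nonempty E := ν.nonempty_of_neZero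
  have hmass_ne : m'.mass ≠ 0 := m'.mass_nonzero_iff.mpr hm'
  refine FiniteMeasure.tendsto_of_tendsto_normalize_testAgainstNN_of_tendsto_mass
    (hS.tendsto_probabilityMeasure_of_tendsto_of_mem hmeas hnhds fun s hs => ?_) hmass
  rw [FiniteMeasure.normalize_eq_of_nonzero _ hm']
  refine ((hmass.inv₀ hmass_ne).mul (NNReal.tendsto_coe.mp (hset s hs))).congr' ?_
  filter_upwards [hmass.eventually_ne hmass_ne] with i hi
  exact ((m i).normalize_eq_of_nonzero ((m i).mass_nonzero_iff.mp hi) s).symm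

end WeakConvergence

lemma tendsto_mul_prod_sub_prod {ι κ : Type*} [DecidableEq ι] {l : Filter κ} {s : Finset ι}
    {c : κ → ℝ} {p q : κ → ι → ℝ} {a t : ι → ℝ}
    (hp : ∀ i ∈ s, Tendsto (p · i) l (𝓝 (a i))) (hq : ∀ i ∈ s, Tendsto (q · i) l (𝓝 (a i)))
    (ht : ∀ i ∈ s, Tendsto (fun n => c n * (p n i - q n i)) l (𝓝 (t i))) :
    Tendsto (fun n => c n * (∏ i ∈ s, p n i - ∏ i ∈ s, q n i)) l
      (𝓝 (∑ k ∈ s, t k * ∏ i ∈ s.erase k, a i)) := by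
  induction s using Finset.induction_on with
  | empty => simpa using tendsto_const_nhds
  | insert j s hj ih =>
    simp only [Finset.forall_mem_insert] at hp hq ht
    have hsum : ∑ k ∈ insert j s, t k * ∏ i ∈ (insert j s).erase k, a i =
        t j * ∏ i ∈ s, a i + a j * ∑ k ∈ s, t k * ∏ i ∈ s.erase k, a i := by
      rw [Finset.sum_insert hj, Finset.erase_insert hj, Finset.mul_sum]
      congr 1
      refine Finset.sum_congr rfl fun k hk => ?_
      rw [Finset.erase_insert_of_ne (ne_of_mem_of_not_mem hk hj).symm,
        Finset.prod_insert fun h => hj (Finset.mem_of_mem_erase h)]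
      ring
    rw [hsum]
    refine ((ht.1.mul (tendsto_finsetProd s hp.2)).add
      (hq.1.mul (ih hp.2 hq.2 ht.2))).congr fun n => ?_
    rw [Finset.prod_insert hj, Finset.prod_insert hj]
    ring

lemma tendsto_zero_of_tendsto_natCast_mul {u : ℕ → ℝ} {t : ℝ}
    (h : Tendsto (fun n : ℕ => (n : ℝ) * u n) atTop (𝓝 t)) : Tendsto u atTop (𝓝 0) := by
  have := h.mul tendsto_inv_atTop_nhds_zero_nat
  rw [mul_zero] at this
  refine this.congr' ?_
  filter_upwards [eventually_ne_atTop 0] with n hn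
  field_simp

section SingleBigJump

open Set

lemma exists_pi_Ioc_mem_nhds_subset {ι : Type*} [Finite ι] {u : Set (ι → ℝ)} (hu : IsOpen u)
    {x : ι → ℝ} (hx : x ∈ u) :
    ∃ a b : ι → ℝ, (∀ i, a i ≠ 0 ∧ b i ≠ 0) ∧ univ.pi (fun i => Ioc (a i) (b i)) ∈ 𝓝 x ∧
      univ.pi (fun i => Ioc (a i) (b i)) ⊆ u := by
  have := Fintype.ofFinite ι
  obtain ⟨ε, hε, hball⟩ := Metric.isOpen_iff.mp hu x hx
  have hne : ∀ y z : ℝ, y < z → ∃ c ∈ Ioo y z, c ≠ 0 := fun y z hyz =>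
    (Ioo_infinite hyz).exists_notMem_finset {0} |>.imp fun c hc => by simpa using hc
  choose a ha ha0 using fun i => hne (x i - ε) (x i) (by linarith)
  choose b hb hb0 using fun i => hne (x i) (x i + ε) (by linarith)
  refine ⟨a, b, fun i => ⟨ha0 i, hb0 i⟩,
    set_pi_mem_nhds finite_univ fun i _ => Ioc_mem_nhds (ha i).2 (hb i).1, fun y hy => hball ?_⟩
  rw [Metric.mem_ball, dist_pi_lt_iff hε]
  intro i
  rw [Real.dist_eq, abs_lt]
  constructor <;> linarith [(hy i trivial).1, (hy i trivial).2, (ha i).1, (hb i).2]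

variable {ι : Type*} [Fintype ι] [DecidableEq ι]

/-- Two independent factors are exceptional at the same time only with probability `O(n⁻²)`, hence
the sum over the single exceptional factor `k`. -/
lemma tendsto_mul_measureReal_pi_inter {E : ι → Type*} [∀ i, MeasurableSpace (E i)]
    {μ : ℕ → ∀ i, Measure (E i)} [∀ n i, IsProbabilityMeasure (μ n i)] {B s : ∀ i, Set (E i)}
    (hB : ∀ i, MeasurableSet (B i)) (hs : ∀ i, MeasurableSet (s i)) {a t : ι → ℝ}
    (ha : ∀ i, Tendsto (fun n => (μ n i).real (s i)) atTop (𝓝 (a i)))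
    (ht : ∀ i, Tendsto (fun n : ℕ => (n : ℝ) * (μ n i).real (s i ∩ B i)) atTop (𝓝 (t i))) :
    Tendsto (fun n : ℕ => (n : ℝ) * (Measure.pi (μ n)).real (univ.pi s ∩ {x | ∃ i, x i ∈ B i}))
      atTop (𝓝 (∑ k, t k * ∏ i ∈ Finset.univ.erase k, a i)) := by
  have hpi : ∀ n (s : ∀ i, Set (E i)), (Measure.pi (μ n)).real (univ.pi s) =
      ∏ i, (μ n i).real (s i) := fun n s => by
    simp only [Measure.real, Measure.pi_pi, ENNReal.toReal_prod]
  have hdiff : ∀ n i, (μ n i).real (s i ∩ B i) =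
      (μ n i).real (s i) - (μ n i).real (s i \ B i) := fun n i => by
    rw [← measureReal_inter_add_sdiff (μ := μ n i) (s := s i) (hB i), add_sub_cancel_right]
  have hsmall : ∀ i, Tendsto (fun n => (μ n i).real (s i ∩ B i)) atTop (𝓝 0) := fun i =>
    tendsto_zero_of_tendsto_natCast_mul (ht i)
  have hset : univ.pi s ∩ {x | ∃ i, x i ∈ B i} = univ.pi s \ univ.pi fun i => s i \ B i := by
    ext x
    simp only [mem_inter_iff, Set.mem_pi, mem_univ, true_imp_iff, mem_ofPred_eq, Set.mem_sdiff]
    grind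
  simp only [hset, hdiff] at ht ⊢
  refine (tendsto_mul_prod_sub_prod (q := fun n i => (μ n i).real (s i \ B i)) (fun i _ => ha i)
    (fun i _ => ?_) fun i _ => ht i).congr fun n => ?_
  · simpa [hdiff] using (ha i).sub (hsmall i)
  · rw [measureReal_sdiff (pi_mono fun i _ => sdiff_subset)
      (.univ_pi fun i => (hs i).diff (hB i)), hpi, hpi]

variable {μ : ℕ → Measure ℝ} [∀ n, IsProbabilityMeasure (μ n)] {ν : Measure ℝ}

lemma tendsto_measureReal_of_compl_mem_nhds_zero (hμ : ∀ n, μ n (Iio 0) = 0)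
    (hν : ∀ z, 0 < z → Tendsto (fun n : ℕ => (n : ℝ) * (μ n).real (Ioi z)) atTop
      (𝓝 (ν.real (Ioi z)))) {s : Set ℝ} (hs : sᶜ ∈ 𝓝 0) :
    Tendsto (fun n => (μ n).real s) atTop (𝓝 0) := by
  obtain ⟨ε, hε, hball⟩ := Metric.mem_nhds_iff.mp hs
  have hsub : s ⊆ Iio 0 ∪ Ioi (ε / 2) := fun x hx => by
    by_contra! h
    simp only [mem_union, mem_Iio, mem_Ioi, not_or, not_lt] at h
    refine hball (?_ : x ∈ _) hx
    rw [Metric.mem_ball, Real.dist_eq, sub_zero, abs_of_nonneg h.1]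
    linarith [h.2]
  refine squeeze_zero (fun _ => measureReal_nonneg) (fun n => ?_)
    (tendsto_zero_of_tendsto_natCast_mul (hν _ (half_pos hε)))
  calc (μ n).real s ≤ (μ n).real (Iio 0 ∪ Ioi (ε / 2)) := measureReal_mono hsub
    _ ≤ (μ n).real (Iio 0) + (μ n).real (Ioi (ε / 2)) := measureReal_union_le _ _
    _ = (μ n).real (Ioi (ε / 2)) := by simp [Measure.real, hμ n]

lemma tendsto_measureReal_of_zero_notMem_frontier (hμ : ∀ n, μ n (Iio 0) = 0)
    (hν : ∀ z, 0 < z → Tendsto (fun n : ℕ => (n : ℝ) * (μ n).real (Ioi z)) atTop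
      (𝓝 (ν.real (Ioi z)))) {s : Set ℝ} (hsm : MeasurableSet s) (hs : 0 ∉ frontier s) :
    Tendsto (fun n => (μ n).real s) atTop (𝓝 (s.indicator 1 0)) := by
  by_cases h0 : (0 : ℝ) ∈ s
  · have hnhds : s ∈ 𝓝 0 := mem_interior_iff_mem_nhds.mp (self_sdiff_frontier s ▸ ⟨h0, hs⟩)
    have := (tendsto_measureReal_of_compl_mem_nhds_zero hμ hν (s := sᶜ)
      (by rwa [compl_compl])).const_sub 1
    simpa [probReal_compl_eq_one_sub hsm, h0] using this
  · rw [indicator_of_notMem h0]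
    refine tendsto_measureReal_of_compl_mem_nhds_zero hμ hν (mem_interior_iff_mem_nhds.mp ?_)
    rw [← self_sdiff_frontier, frontier_compl]
    exact ⟨h0, hs⟩

lemma zero_notMem_frontier_Ioc {a b : ℝ} (ha : a ≠ 0) (hb : b ≠ 0) : 0 ∉ frontier (Ioc a b) := by
  obtain hab | hab := lt_or_ge a b
  · simp [frontier_Ioc hab, ha.symm, hb.symm]
  · simp [Ioc_eq_empty hab.not_gt]

lemma tendsto_mul_measureReal_Ioc_inter_Ioi
    (hν_fin : ∀ z, 0 < z → ν (Ioi z) ≠ ∞)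
    (hν : ∀ z, 0 < z → Tendsto (fun n : ℕ => (n : ℝ) * (μ n).real (Ioi z)) atTop
      (𝓝 (ν.real (Ioi z)))) (a b : ℝ) {δ : ℝ} (hδ : 0 < δ) :
    Tendsto (fun n : ℕ => (n : ℝ) * (μ n).real (Ioc a b ∩ Ioi δ)) atTop
      (𝓝 (ν.real (Ioc a b ∩ Ioi δ))) := by
  have hset : Ioc a b ∩ Ioi δ = Ioi (max a δ) \ Ioi (max b (max a δ)) := by
    ext x
    simp only [mem_inter_iff, mem_Ioc, mem_Ioi, Set.mem_sdiff, max_lt_iff]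
    grind
  have hpos : 0 < max a δ := hδ.trans_le (le_max_right _ _)
  have hdiff : ∀ κ : Measure ℝ, κ (Ioi (max a δ)) ≠ ∞ → κ.real (Ioc a b ∩ Ioi δ) =
      κ.real (Ioi (max a δ)) - κ.real (Ioi (max b (max a δ))) := fun κ hκ => by
    rw [hset, measureReal_sdiff (Ioi_subset_Ioi (le_max_right _ _)) measurableSet_Ioi hκ]
  rw [hdiff ν (hν_fin _ hpos)]
  simp only [fun n => hdiff (μ n) (measure_ne_top _ _), mul_sub]
  exact (hν _ hpos).sub (hν _ (hpos.trans_le (le_max_right _ _)))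

variable {μ : ℕ → ι → Measure ℝ} [∀ n i, IsProbabilityMeasure (μ n i)] {ν : ι → Measure ℝ}

lemma measureReal_sum_map_single_pi (hν : ∀ i z, 0 < z → ν i (Ioi z) ≠ ∞) {δ : ℝ} (hδ : 0 < δ)
    {s : ι → Set ℝ} (hs : ∀ i, MeasurableSet (s i)) :
    (∑ k, ((ν k).restrict (Ioi δ)).map (Pi.single k)).real (univ.pi s) =
      ∑ k, (ν k).real (s k ∩ Ioi δ) * ∏ i ∈ Finset.univ.erase k, (s i).indicator 1 0 := by
  have hfin : ∀ k, IsFiniteMeasure ((ν k).restrict (Ioi δ)) := fun k =>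
    ⟨by simpa using (hν k δ hδ).lt_top⟩
  have hsum : ∀ κ : ι → Measure (ι → ℝ), (∀ k, IsFiniteMeasure (κ k)) →
      (∑ k, κ k).real (univ.pi s) = ∑ k, (κ k).real (univ.pi s) := fun κ _ => by
    simp only [Measure.real, Measure.finsetSum_apply]
    exact ENNReal.toReal_sum fun k _ => measure_ne_top _ _
  rw [hsum _ fun k => inferInstance]
  refine Finset.sum_congr rfl fun k _ => ?_
  rw [map_measureReal_apply (continuous_single k).measurable (.univ_pi hs)]
  have hpre : Pi.single k ⁻¹' univ.pi s =
      {t : ℝ | t ∈ s k ∧ ∀ i ∈ Finset.univ.erase k, (0 : ℝ) ∈ s i} := by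
    ext t
    simp only [mem_preimage, mem_univ_pi, mem_ofPred_eq, Finset.mem_erase, Finset.mem_univ,
      and_true]
    refine ⟨fun h => ⟨by simpa using h k, fun i hi => by simpa [hi] using h i⟩, fun h i => ?_⟩
    obtain rfl | hi := eq_or_ne i k
    · simpa using h.1
    · simpa [hi] using h.2 i hi
  by_cases h0 : ∀ i ∈ Finset.univ.erase k, (0 : ℝ) ∈ s i
  · rw [hpre, Finset.prod_congr rfl fun i hi => indicator_of_mem (h0 i hi) 1]
    simp only [eq_true h0, and_true, ofPred_mem_eq, measureReal_restrict_apply (hs k),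
      Pi.one_apply, Finset.prod_const_one, mul_one]
  · obtain ⟨i, hi, h0i⟩ := by simpa only [not_forall] using h0
    rw [hpre, Finset.prod_eq_zero hi (indicator_of_notMem h0i _)]
    simp only [h0, and_false, ofPred_false, measureReal_empty, mul_zero]

lemma tendsto_integral_smul_restrict_pi (hμ : ∀ n i, μ n i (Iio 0) = 0)
    (hν_fin : ∀ i z, 0 < z → ν i (Ioi z) ≠ ∞)
    (hν : ∀ i z, 0 < z → Tendsto (fun n : ℕ => (n : ℝ) * (μ n i).real (Ioi z)) atTop
      (𝓝 ((ν i).real (Ioi z))))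
    {δ : ℝ} (hδ : 0 < δ) (g : BoundedContinuousFunction (ι → ℝ) ℝ) :
    Tendsto (fun n : ℕ => ∫ z, g z ∂((n : ℝ≥0) • (Measure.pi (μ n)).restrict {z | ∃ i, δ < z i}))
      atTop (𝓝 (∫ z, g z ∂(∑ k, ((ν k).restrict (Ioi δ)).map (Pi.single k)))) := by
  have hν_restrict : ∀ k, IsFiniteMeasure ((ν k).restrict (Ioi δ)) := fun k =>
    ⟨by simpa using (hν_fin k δ hδ).lt_top⟩
  have hbox : ∀ s : ι → Set ℝ, (∀ i, MeasurableSet (s i)) → (∀ i, 0 ∉ frontier (s i)) →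
      (∀ i, Tendsto (fun n : ℕ => (n : ℝ) * (μ n i).real (s i ∩ Ioi δ)) atTop
        (𝓝 ((ν i).real (s i ∩ Ioi δ)))) →
      Tendsto (fun n : ℕ =>
          ((n : ℝ≥0) • (Measure.pi (μ n)).restrict {z | ∃ i, δ < z i}).real (univ.pi s))
        atTop (𝓝 ((∑ k, ((ν k).restrict (Ioi δ)).map (Pi.single k)).real (univ.pi s))) := by
    intro s hs h0 ht
    rw [measureReal_sum_map_single_pi hν_fin hδ hs]
    refine (tendsto_mul_measureReal_pi_inter (fun _ => measurableSet_Ioi) hs (fun i =>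
      tendsto_measureReal_of_zero_notMem_frontier (hμ · i) (hν i) (hs i) (h0 i)) ht).congr
      fun n => ?_
    rw [measureReal_nnreal_smul_apply, measureReal_restrict_apply (.univ_pi hs)]
    rfl
  refine tendsto_integral_of_isPiSystem
    (S := {s | ∃ a b : ι → ℝ, (∀ i, a i ≠ 0 ∧ b i ≠ 0) ∧ s = univ.pi fun i => Ioc (a i) (b i)})
    ?_ ?_ ?_ ?_ ?_ g
  · rintro _ ⟨a, b, hab, rfl⟩ _ ⟨a', b', hab', rfl⟩ _
    refine ⟨a ⊔ a', b ⊓ b', fun i => ?_, by simp [← pi_inter_distrib, Ioc_inter_Ioc]⟩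
    grind [Pi.sup_apply, Pi.inf_apply]
  · rintro _ ⟨a, b, -, rfl⟩
    exact .univ_pi fun _ => measurableSet_Ioc
  · intro u hu x hx
    obtain ⟨a, b, hab, hmem, hsub⟩ := exists_pi_Ioc_mem_nhds_subset hu hx
    exact ⟨_, ⟨a, b, hab, rfl⟩, hmem, hsub⟩
  · simpa using hbox (fun _ => univ) (fun _ => .univ) (by simp) (by simpa using (hν · δ hδ))
  · rintro _ ⟨a, b, hab, rfl⟩
    exact hbox _ (fun _ => measurableSet_Ioc)
      (fun i => zero_notMem_frontier_Ioc (hab i).1 (hab i).2)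
      (fun i => tendsto_mul_measureReal_Ioc_inter_Ioi (hν_fin i) (hν i) _ _ hδ)

lemma tendsto_mul_integral_pi (hμ : ∀ n i, μ n i (Iio 0) = 0)
    (hν_fin : ∀ i z, 0 < z → ν i (Ioi z) ≠ ∞)
    (hν : ∀ i z, 0 < z → Tendsto (fun n : ℕ => (n : ℝ) * (μ n i).real (Ioi z)) atTop
      (𝓝 ((ν i).real (Ioi z))))
    {δ : ℝ} (hδ : 0 < δ) (g : BoundedContinuousFunction (ι → ℝ) ℝ)
    (hg : ∀ z, (∀ i, z i ≤ δ) → g z = 0) :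
    Tendsto (fun n : ℕ => (n : ℝ) * ∫ z, g z ∂(Measure.pi (μ n))) atTop
      (𝓝 (∑ k, ∫ t, g (Pi.single k t) ∂(ν k))) := by
  have hν_restrict : ∀ k, IsFiniteMeasure ((ν k).restrict (Ioi δ)) := fun k =>
    ⟨by simpa using (hν_fin k δ hδ).lt_top⟩
  have hpre : ∀ n : ℕ,
      ∫ z, g z ∂((n : ℝ≥0) • (Measure.pi (μ n)).restrict {z | ∃ i, δ < z i}) =
        n * ∫ z, g z ∂(Measure.pi (μ n)) := fun n => by
    rw [integral_smul_nnreal_measure, setIntegral_eq_integral_of_forall_compl_eq_zero]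
    · rfl
    · exact fun z hz => hg z (by simpa using hz)
  have hlim : ∫ z, g z ∂(∑ k, ((ν k).restrict (Ioi δ)).map (Pi.single k)) =
      ∑ k, ∫ t, g (Pi.single k t) ∂(ν k) := by
    rw [integral_finsetSum_measure fun k _ => g.integrable _]
    refine Finset.sum_congr rfl fun k _ => ?_
    rw [integral_map (continuous_single k).measurable.aemeasurable
      g.continuous.aestronglyMeasurable]
    refine setIntegral_eq_integral_of_forall_compl_eq_zero fun t ht => hg _ fun i => ?_
    rw [Pi.single_apply]
    split_ifs
    exacts [by simpa using ht, hδ.le]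
  simpa only [hpre, hlim] using tendsto_integral_smul_restrict_pi hμ hν_fin hν hδ g

end SingleBigJump

lemma integral_comap_eq_integral_extend {α β : Type*} [MeasurableSpace α] [MeasurableSpace β]
    {e : α → β} (he : MeasurableEmbedding e) (μ : Measure β) (f : α → ℝ) :
    ∫ x, f x ∂(μ.comap e) = ∫ y, Function.extend e f 0 y ∂μ := by
  calc ∫ x, f x ∂(μ.comap e)
      = ∫ x, Function.extend e f 0 (e x) ∂(μ.comap e) := by
        simp_rw [he.injective.extend_apply]
    _ = ∫ y, Function.extend e f 0 y ∂((μ.comap e).map e) := (he.integral_map _).symm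
    _ = ∫ y in Set.range e, Function.extend e f 0 y ∂μ := by rw [he.map_comap]
    _ = _ := setIntegral_eq_integral_of_forall_compl_eq_zero fun y hy =>
        Function.extend_apply' _ _ _ hy

section PolarCoordinates

variable {d : ℕ}

lemma isClosed_nonneg_orthant (d : ℕ) :
    IsClosed {x : EuclideanSpace ℝ (Fin d) | ∀ i, 0 ≤ x i} := by
  simp only [Set.ofPred_forall]
  exact isClosed_iInter fun i => isClosed_le continuous_const (by fun_prop)

lemma isClosed_posSphere (d : ℕ) : IsClosed (posSphere d) :=
  (isClosed_nonneg_orthant d).inter (isClosed_eq continuous_norm continuous_const)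

instance (d : ℕ) : CompactSpace (posSphere d) :=
  isCompact_iff_compactSpace.mp <|
    (isCompact_sphere (0 : EuclideanSpace ℝ (Fin d)) 1).of_isClosed_subset (isClosed_posSphere d)
      fun w hw => by simpa using hw.2

instance : LocallyCompactSpace PosRadii := (isOpen_Ioi (a := (0 : ℝ≥0∞))).locallyCompactSpace

lemma measurableEmbedding_coe_posRadii : MeasurableEmbedding (Subtype.val : PosRadii → ℝ≥0∞) :=
  .subtype_coe measurableSet_Ioi

lemma measurableEmbedding_coe_polar (d : ℕ) : MeasurableEmbedding
    (Prod.map Subtype.val Subtype.val :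
      PosRadii × posSphere d → ℝ≥0∞ × EuclideanSpace ℝ (Fin d)) :=
  measurableEmbedding_coe_posRadii.prodMap (.subtype_coe (isClosed_posSphere d).measurableSet)

lemma exists_forall_ofReal_lt_of_isCompact {K : Set PosRadii} (hK : IsCompact K) :
    ∃ ε : ℝ, 0 < ε ∧ ∀ r ∈ K, ENNReal.ofReal ε < r.1 := by
  rcases K.eq_empty_or_nonempty with rfl | hne
  · exact ⟨1, one_pos, fun r hr => absurd hr (Set.notMem_empty r)⟩
  obtain ⟨r₀, -, hmin⟩ := hK.exists_isMinOn hne continuous_subtype_val.continuousOn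
  obtain ⟨ε, hε0, hε⟩ := ENNReal.lt_iff_exists_nnreal_btwn.mp r₀.2
  refine ⟨ε, by simpa using hε0, fun r hr => ?_⟩
  rw [ENNReal.ofReal_coe_nnreal]
  exact hε.trans_le (hmin hr)

/-- The non-negative orthant of `ℝᵈ` without the origin, which polar coordinates identify with the
part of `PosRadii × posSphere d` of finite radii. -/
def puncturedOrthant (d : ℕ) : Set (EuclideanSpace ℝ (Fin d)) :=
  {x | (∀ i, 0 ≤ x i) ∧ x ≠ 0}

lemma coe_posSphere_mem_puncturedOrthant (w : posSphere d) : w.1 ∈ puncturedOrthant d :=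
  ⟨w.2.1, norm_ne_zero_iff.mp (w.2.2 ▸ one_ne_zero)⟩

/-- The angle `x / ‖x‖` of a vector of the punctured orthant. -/
noncomputable def direction (x : puncturedOrthant d) : posSphere d :=
  ⟨‖x.1‖⁻¹ • x.1, fun i => mul_nonneg (by positivity) (x.2.1 i), norm_smul_inv_norm x.2.2⟩

/-- The polar coordinates `(‖x‖, x / ‖x‖)` of a vector of the punctured orthant. -/
noncomputable def toPolar (x : puncturedOrthant d) : PosRadii × posSphere d :=
  (⟨ENNReal.ofReal ‖x.1‖, ENNReal.ofReal_pos.mpr (norm_pos_iff.mpr x.2.2)⟩, direction x)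

lemma continuous_toPolar : Continuous (toPolar (d := d)) := by
  have hnorm : Continuous fun x : puncturedOrthant d => ‖x.1‖ :=
    continuous_norm.comp continuous_subtype_val
  exact ((ENNReal.continuous_ofReal.comp hnorm).subtype_mk _).prodMk
    (((hnorm.inv₀ fun x => norm_ne_zero_iff.mpr x.2.2).smul continuous_subtype_val).subtype_mk _)

lemma smul_mem_puncturedOrthant {x : EuclideanSpace ℝ (Fin d)} {t : ℝ} (ht : 0 < t) :
    t • x ∈ puncturedOrthant d ↔ x ∈ puncturedOrthant d := by
  simp [puncturedOrthant, mul_nonneg_iff_of_pos_left ht, ht.ne']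

lemma toPolar_smul {t : ℝ} (ht : 0 < t) (w : posSphere d)
    (hw : t • (w : EuclideanSpace ℝ (Fin d)) ∈ puncturedOrthant d) :
    toPolar ⟨t • w.1, hw⟩ = (⟨ENNReal.ofReal t, ENNReal.ofReal_pos.mpr ht⟩, w) := by
  have hnorm : ‖t • w.1‖ = t := by rw [norm_smul, w.2.2, mul_one, Real.norm_of_nonneg ht.le]
  refine Prod.ext (Subtype.ext ?_) (Subtype.ext ?_)
  · simp only [toPolar, hnorm]
  · simp only [toPolar, direction, hnorm, smul_smul, inv_mul_cancel₀ ht.ne', one_smul]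

/-- The function on Euclidean space given by `f` in polar coordinates, extended by zero outside the
punctured orthant. -/
noncomputable def polarLift (f : PosRadii × posSphere d → ℝ) : EuclideanSpace ℝ (Fin d) → ℝ :=
  Function.extend Subtype.val (f ∘ toPolar) 0

lemma polarLift_of_mem (f : PosRadii × posSphere d → ℝ) {x : EuclideanSpace ℝ (Fin d)}
    (hx : x ∈ puncturedOrthant d) : polarLift f x = f (toPolar ⟨x, hx⟩) :=
  Subtype.val_injective.extend_apply (f ∘ toPolar) 0 ⟨x, hx⟩

lemma polarLift_of_notMem (f : PosRadii × posSphere d → ℝ) {x : EuclideanSpace ℝ (Fin d)}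
    (hx : x ∉ puncturedOrthant d) : polarLift f x = 0 :=
  Function.extend_apply' _ _ _ (by simpa using hx)

lemma polarLift_eq_extend (f : PosRadii × posSphere d → ℝ) (x : EuclideanSpace ℝ (Fin d)) :
    polarLift f x =
      Function.extend (Prod.map Subtype.val Subtype.val) f 0 (ENNReal.ofReal ‖x‖, ‖x‖⁻¹ • x) := by
  by_cases hx : x ∈ puncturedOrthant d
  · rw [polarLift_of_mem f hx]
    exact ((measurableEmbedding_coe_polar d).injective.extend_apply f 0 (toPolar ⟨x, hx⟩)).symm
  · rw [polarLift_of_notMem f hx, Function.extend_apply', Pi.zero_apply]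
    rintro ⟨⟨r, w⟩, hrw⟩
    obtain ⟨hr, hw⟩ := Prod.mk.inj hrw
    have hnorm : 0 < ‖x‖ := ENNReal.ofReal_pos.mp (hr ▸ r.2)
    have hdir : ‖x‖⁻¹ • x ∈ puncturedOrthant d :=
      hw ▸ coe_posSphere_mem_puncturedOrthant w
    exact hx ((smul_mem_puncturedOrthant (inv_pos.mpr hnorm)).mp hdir)

lemma exists_abs_polarLift_le {f : PosRadii × posSphere d → ℝ} (hf : Continuous f)
    (hfc : HasCompactSupport f) : ∃ B, ∀ x, |polarLift f x| ≤ B := by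
  obtain ⟨B, hB⟩ := hfc.exists_bound_of_continuous hf
  refine ⟨max B 0, fun x => ?_⟩
  by_cases hx : x ∈ puncturedOrthant d
  · rw [polarLift_of_mem f hx]
    exact (hB _).trans (le_max_left _ _)
  · rw [polarLift_of_notMem f hx, abs_zero]
    exact le_max_right _ _

lemma polarLift_eventuallyEq_zero {f : PosRadii × posSphere d → ℝ} (hfc : HasCompactSupport f) :
    polarLift f =ᶠ[𝓝 0] 0 := by
  obtain ⟨ε, hε, hlt⟩ := exists_forall_ofReal_lt_of_isCompact (hfc.isCompact.image continuous_fst)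
  filter_upwards [Metric.ball_mem_nhds 0 hε] with x hx
  by_cases hmem : x ∈ puncturedOrthant d
  · rw [polarLift_of_mem f hmem]
    refine image_eq_zero_of_notMem_tsupport fun h => ?_
    exact (hlt _ (Set.mem_image_of_mem _ h)).not_ge
      (ENNReal.ofReal_le_ofReal (mem_ball_zero_iff.mp hx).le)
  · exact polarLift_of_notMem f hmem

lemma continuousOn_polarLift {f : PosRadii × posSphere d → ℝ} (hf : Continuous f)
    (hfc : HasCompactSupport f) :
    ContinuousOn (polarLift f) {x | ∀ i, 0 ≤ x i} := by
  have hpunctured : ContinuousOn (polarLift f) (puncturedOrthant d) := by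
    rw [continuousOn_iff_continuous_domRestrict]
    exact (hf.comp continuous_toPolar).congr fun x => (polarLift_of_mem f x.2).symm
  intro x hx
  obtain rfl | hx0 := eq_or_ne x 0
  · exact (continuousAt_const.congr (polarLift_eventuallyEq_zero hfc).symm).continuousWithinAt
  · exact (continuousWithinAt_inter (isOpen_compl_singleton.mem_nhds hx0)).mp
      (hpunctured x ⟨hx, hx0⟩)

lemma integral_polarLaw {Ω : Type*} [MeasurableSpace Ω] (P : Measure Ω)
    {X : Ω → EuclideanSpace ℝ (Fin d)} (hX : Measurable X) {b : ℝ} (hb : 0 < b)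
    {f : PosRadii × posSphere d → ℝ} (hf : Measurable f) :
    ∫ p, f p ∂(polarLaw P X b) = ∫ ω, polarLift f (b⁻¹ • X ω) ∂P := by
  have he := measurableEmbedding_coe_polar d
  rw [polarLaw, integral_comap_eq_integral_extend he, integral_map (by fun_prop)
    (he.measurable_extend hf measurable_zero).aestronglyMeasurable]
  refine integral_congr_ae (ae_of_all _ fun ω => ?_)
  have hnorm : ‖b⁻¹ • X ω‖ = ‖X ω‖ / b := by
    rw [norm_smul, Real.norm_of_nonneg (inv_nonneg.mpr hb.le), div_eq_inv_mul]
  have hdir : (‖X ω‖ / b)⁻¹ • b⁻¹ • X ω = ‖X ω‖⁻¹ • X ω := by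
    rw [smul_smul, inv_div, div_eq_mul_inv, mul_right_comm, mul_inv_cancel₀ hb.ne', one_mul]
  simp only [polarLift_eq_extend, hnorm, hdir]

end PolarCoordinates

section PowerMeasure

/-- The measure on the line with density `α x ^ (-α - 1)` on `(0, ∞)`, of which `powerMeasure α` is
the copy on `(0, ∞]`. -/
noncomputable def powerDensity (α : ℝ) : Measure ℝ :=
  (volume.restrict (Set.Ioi (0 : ℝ))).withDensity fun x => ENNReal.ofReal (α * x ^ (-α - 1))

lemma ae_powerDensity_pos (α : ℝ) : ∀ᵐ t ∂(powerDensity α), 0 < t :=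
  (withDensity_absolutelyContinuous _ _).ae_le (ae_restrict_mem measurableSet_Ioi)

lemma integral_powerDensity {α : ℝ} (hα : 0 < α) (g : ℝ → ℝ) :
    ∫ t, g t ∂(powerDensity α) = ∫ t in Set.Ioi 0, α * t ^ (-α - 1) * g t := by
  rw [powerDensity, integral_withDensity_eq_integral_toReal_smul (by fun_prop)
    (ae_of_all _ fun _ => ENNReal.ofReal_lt_top)]
  refine setIntegral_congr_fun measurableSet_Ioi fun t ht => ?_
  simp only [smul_eq_mul]
  rw [ENNReal.toReal_ofReal (mul_nonneg hα.le (Real.rpow_nonneg (le_of_lt ht) _))]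

lemma powerDensity_Ioi {α : ℝ} (hα : 0 < α) {z : ℝ} (hz : 0 < z) :
    powerDensity α (Set.Ioi z) = ENNReal.ofReal (z ^ (-α)) := by
  have hlt : -α - 1 < -1 := by linarith
  have hint : IntegrableOn (fun x : ℝ => α * x ^ (-α - 1)) (Set.Ioi z) :=
    (integrableOn_Ioi_rpow_of_lt hlt hz).const_mul α
  rw [powerDensity, withDensity_apply _ measurableSet_Ioi,
    Measure.restrict_restrict measurableSet_Ioi,
    Set.inter_eq_left.mpr (Set.Ioi_subset_Ioi hz.le),
    ← ofReal_integral_eq_lintegral_ofReal hint]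
  · rw [integral_const_mul, integral_Ioi_rpow_of_lt hlt hz]
    congr 1
    rw [sub_add_cancel]
    field_simp
  · filter_upwards [ae_restrict_mem measurableSet_Ioi] with t ht
    exact mul_nonneg hα.le (Real.rpow_nonneg (hz.trans ht).le _)

lemma powerDensity_real_Ioi {α : ℝ} (hα : 0 < α) {z : ℝ} (hz : 0 < z) :
    (powerDensity α).real (Set.Ioi z) = z ^ (-α) := by
  rw [Measure.real, powerDensity_Ioi hα hz, ENNReal.toReal_ofReal (Real.rpow_nonneg hz.le _)]

lemma integral_powerDensity_comp_mul_left {α : ℝ} (hα : 0 < α) {c : ℝ} (hc : 0 < c) (g : ℝ → ℝ) :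
    ∫ t, g (c * t) ∂(powerDensity α) = c ^ α * ∫ t, g t ∂(powerDensity α) := by
  have h := integral_comp_mul_left_Ioi (fun u => α * (u / c) ^ (-α - 1) * g u) 0 hc
  rw [integral_powerDensity hα, integral_powerDensity hα, ← integral_const_mul]
  simp only [mul_div_cancel_left₀ _ hc.ne', mul_zero] at h
  rw [h, smul_eq_mul, ← integral_const_mul]
  refine setIntegral_congr_fun measurableSet_Ioi fun t ht => ?_
  rw [Real.div_rpow (le_of_lt ht) hc.le, Real.rpow_sub hc, Real.rpow_neg hc.le, Real.rpow_one]
  have := (Real.rpow_pos_of_pos hc α).ne'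
  field_simp

lemma integral_powerMeasure {α : ℝ} {g : PosRadii → ℝ} (hg : Measurable g) {h : ℝ → ℝ}
    (hgh : ∀ t (ht : 0 < t), g ⟨ENNReal.ofReal t, ENNReal.ofReal_pos.mpr ht⟩ = h t) :
    ∫ r, g r ∂(powerMeasure α) = ∫ t, h t ∂(powerDensity α) := by
  have he := measurableEmbedding_coe_posRadii
  rw [powerMeasure, integral_comap_eq_integral_extend he, integral_map
    ENNReal.measurable_ofReal.aemeasurable
    (he.measurable_extend hg measurable_zero).aestronglyMeasurable]
  refine integral_congr_ae ?_
  filter_upwards [ae_powerDensity_pos α] with t ht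
  rw [← hgh t ht]
  exact he.injective.extend_apply g 0 ⟨ENNReal.ofReal t, ENNReal.ofReal_pos.mpr ht⟩

lemma powerMeasure_setOf_ofReal_lt {α : ℝ} (hα : 0 < α) {z : ℝ} (hz : 0 < z) :
    powerMeasure α {r | ENNReal.ofReal z < r.1} = ENNReal.ofReal (z ^ (-α)) := by
  have himage : Subtype.val '' {r : PosRadii | ENNReal.ofReal z < r.1} =
      Set.Ioi (ENNReal.ofReal z) := by
    rw [show {r : PosRadii | ENNReal.ofReal z < r.1} = Subtype.val ⁻¹' Set.Ioi _ from rfl,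
      Subtype.image_preimage_coe]
    exact Set.inter_eq_right.mpr (Set.Ioi_subset_Ioi zero_le)
  have hpre : ENNReal.ofReal ⁻¹' Set.Ioi (ENNReal.ofReal z) = Set.Ioi z :=
    Set.ext fun t => ENNReal.ofReal_lt_ofReal_iff_of_nonneg hz.le
  rw [powerMeasure, measurableEmbedding_coe_posRadii.comap_apply, himage,
    Measure.map_apply ENNReal.measurable_ofReal measurableSet_Ioi, hpre]
  exact powerDensity_Ioi hα hz

lemma isFiniteMeasureOnCompacts_powerMeasure {α : ℝ} (hα : 0 < α) :
    IsFiniteMeasureOnCompacts (powerMeasure α) := by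
  refine ⟨fun K hK => ?_⟩
  obtain ⟨ε, hε, h⟩ := exists_forall_ofReal_lt_of_isCompact hK
  calc powerMeasure α K ≤ powerMeasure α {r | ENNReal.ofReal ε < r.1} := measure_mono h
    _ < ∞ := by rw [powerMeasure_setOf_ofReal_lt hα hε]; exact ENNReal.ofReal_lt_top

end PowerMeasure

section Uniqueness

lemma VagueTendsto.unique {E : Type*} [TopologicalSpace E] [T2Space E] [LocallyCompactSpace E]
    [SecondCountableTopology E] [MeasurableSpace E] [BorelSpace E] {μ : ℕ → Measure E}
    {ν ν' : Measure E} [IsFiniteMeasureOnCompacts ν] [IsFiniteMeasureOnCompacts ν']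
    (h : VagueTendsto μ ν) (h' : VagueTendsto μ ν') : ν = ν' :=
  Measure.ext_of_integral_eq_on_compactlySupported fun f => tendsto_nhds_unique (h f) (h' f)

lemma eq_of_prod_eq_prod_left {E F : Type*} [MeasurableSpace E] [MeasurableSpace F]
    {μ : Measure E} {ν ν' : Measure F} [SFinite ν] [SFinite ν'] {s : Set E} (hs0 : μ s ≠ 0)
    (hs : μ s ≠ ∞) (h : μ.prod ν = μ.prod ν') : ν = ν' := by
  ext t -
  have := congrArg (fun κ => κ (s ×ˢ t)) h
  simpa only [Measure.prod_prod, ENNReal.mul_right_inj hs0 hs] using this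

lemma IsAngularMeasure.unique {d : ℕ} {Ω : Type*} [MeasurableSpace Ω] {P : Measure Ω}
    {X : Ω → EuclideanSpace ℝ (Fin d)} {α : ℝ} (hα : 0 < α) {b : ℕ → ℝ}
    {H H' : Measure (posSphere d)} (hH : IsAngularMeasure P X α b H)
    (hH' : IsAngularMeasure P X α b H') : H = H' := by
  have := hH.finite
  have := hH'.finite
  have := isFiniteMeasureOnCompacts_powerMeasure hα
  have hmass : powerMeasure α {r | ENNReal.ofReal 1 < r.1} = 1 := by
    rw [powerMeasure_setOf_ofReal_lt hα one_pos, Real.one_rpow, ENNReal.ofReal_one]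
  exact eq_of_prod_eq_prod_left (hmass ▸ one_ne_zero) (hmass ▸ ENNReal.one_ne_top)
    (hH.vague.unique hH'.vague)

end Uniqueness

section SpectralMeasure

lemma support_smul_dirac {E : Type*} [TopologicalSpace E] [T1Space E] [MeasurableSpace E]
    [MeasurableSingletonClass E] {c : ℝ≥0∞} (hc : c ≠ 0) (x : E) :
    (c • Measure.dirac x).support = {x} := by
  refine Set.eq_singleton_iff_unique_mem.mpr ⟨?_, fun y hy => ?_⟩
  · refine (Measure.mem_support_iff_forall x).mpr fun U hU => ?_
    simpa [Measure.dirac_apply_of_mem (mem_of_mem_nhds hU)] using hc.bot_lt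
  · by_contra hyx
    simpa using (Measure.mem_support_iff_forall y).mp hy {x}ᶜ (isOpen_compl_singleton.mem_nhds hyx)

lemma support_finsetSum {E ι : Type*} [TopologicalSpace E] [MeasurableSpace E] (s : Finset ι)
    (μ : ι → Measure E) : (∑ k ∈ s, μ k).support = ⋃ k ∈ s, (μ k).support := by
  classical
  induction s using Finset.induction_on with
  | empty => simp
  | insert k s hk ih =>
    rw [Finset.sum_insert hk, Measure.support_add, ih, Finset.set_biUnion_insert]

variable {d : ℕ} {ι : Type*} [Fintype ι]

/-- The discrete measure with mass `‖a k‖ ^ α` at the direction of each vector `a k`: the angular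
measure with index `α` of `∑ k, Y k • a k` for independent standardised `Y k`. -/
noncomputable def spectralMeasure (α : ℝ) (a : ι → puncturedOrthant d) : Measure (posSphere d) :=
  ∑ k, ENNReal.ofReal (‖(a k).1‖ ^ α) • Measure.dirac (direction (a k))

instance (α : ℝ) (a : ι → puncturedOrthant d) : IsFiniteMeasure (spectralMeasure α a) := by
  refine ⟨?_⟩
  simp only [spectralMeasure, Measure.finsetSum_apply, Measure.smul_apply, smul_eq_mul,
    measure_univ, mul_one]
  exact ENNReal.sum_lt_top.mpr fun k _ => ENNReal.ofReal_lt_top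

lemma support_spectralMeasure (α : ℝ) (a : ι → puncturedOrthant d) :
    (spectralMeasure α a).support = Set.range fun k => direction (a k) := by
  have hmass : ∀ k, ENNReal.ofReal (‖(a k).1‖ ^ α) ≠ 0 := fun k =>
    (ENNReal.ofReal_pos.mpr (Real.rpow_pos_of_pos (norm_pos_iff.mpr (a k).2.2) α)).ne'
  simp [spectralMeasure, support_finsetSum, support_smul_dirac (hmass _)]

lemma spectralMeasure_ne_zero [Nonempty ι] (α : ℝ) (a : ι → puncturedOrthant d) :
    spectralMeasure α a ≠ 0 := by
  rw [← Measure.nonempty_support_iff, support_spectralMeasure]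
  exact Set.range_nonempty _

lemma integral_spectralMeasure (α : ℝ) (a : ι → puncturedOrthant d) (f : posSphere d → ℝ) :
    ∫ w, f w ∂(spectralMeasure α a) = ∑ k, ‖(a k).1‖ ^ α * f (direction (a k)) := by
  rw [spectralMeasure, integral_finsetSum_measure]
  · refine Finset.sum_congr rfl fun k _ => ?_
    rw [integral_smul_measure, integral_dirac, ENNReal.toReal_ofReal (by positivity), smul_eq_mul]
  · exact fun k _ => (integrable_dirac (by simp)).smul_measure ENNReal.ofReal_ne_top

lemma extremalDependence_spectralMeasure_two (a : ι → puncturedOrthant d) (i j : Fin d) :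
    extremalDependence (spectralMeasure 2 a) i j = ∑ k, (a k).1 i * (a k).1 j := by
  rw [extremalDependence, integral_spectralMeasure]
  refine Finset.sum_congr rfl fun k _ => ?_
  have hnorm : ‖(a k).1‖ ≠ 0 := norm_ne_zero_iff.mpr (a k).2.2
  simp only [direction, PiLp.smul_apply, smul_eq_mul, Real.rpow_two]
  field_simp

lemma integral_prod_spectralMeasure {α : ℝ} (hα : 0 < α) (a : ι → puncturedOrthant d)
    {f : PosRadii × posSphere d → ℝ} (hf : Continuous f) (hfc : HasCompactSupport f) :
    ∫ p, f p ∂((powerMeasure α).prod (spectralMeasure α a)) =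
      ∑ k, ∫ t, polarLift f (t • (a k).1) ∂(powerDensity α) := by
  have := isFiniteMeasureOnCompacts_powerMeasure hα
  rw [integral_prod_symm _ (hf.integrable_of_hasCompactSupport hfc), integral_spectralMeasure]
  refine Finset.sum_congr rfl fun k _ => ?_
  have hnorm : 0 < ‖(a k).1‖ := norm_pos_iff.mpr (a k).2.2
  have hray : ∀ t : ℝ, 0 < t → t • (direction (a k)).1 ∈ puncturedOrthant d := fun t ht =>
    (smul_mem_puncturedOrthant ht).mpr (coe_posSphere_mem_puncturedOrthant _)
  have hslice : Measurable fun r => f (r, direction (a k)) :=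
    (hf.comp (Continuous.prodMk_left _)).measurable
  calc ‖(a k).1‖ ^ α * ∫ r, f (r, direction (a k)) ∂(powerMeasure α)
      = ‖(a k).1‖ ^ α * ∫ t, polarLift f (t • (direction (a k)).1) ∂(powerDensity α) := by
        rw [integral_powerMeasure hslice fun t ht => ?_]
        rw [polarLift_of_mem f (hray t ht), toPolar_smul ht]
    _ = ∫ t, polarLift f ((‖(a k).1‖ * t) • (direction (a k)).1) ∂(powerDensity α) :=
        (integral_powerDensity_comp_mul_left hα hnorm
          fun t => polarLift f (t • (direction (a k)).1)).symm
    _ = ∫ t, polarLift f (t • (a k).1) ∂(powerDensity α) := by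
        simp only [direction, smul_smul, mul_comm ‖(a k).1‖ _, mul_inv_cancel_right₀ hnorm.ne']

end SpectralMeasure

section LinearCombination

variable {d : ℕ} {ι : Type*} [Fintype ι]

lemma exists_boundedContinuousFunction_eq_polarLift_sum {a : ι → EuclideanSpace ℝ (Fin d)}
    (ha : ∀ k i, 0 ≤ a k i) {f : PosRadii × posSphere d → ℝ} (hf : Continuous f)
    (hfc : HasCompactSupport f) :
    ∃ g : BoundedContinuousFunction (ι → ℝ) ℝ, ∃ δ > 0,
      (∀ z, 0 ≤ z → g z = polarLift f (∑ k, z k • a k)) ∧ ∀ z, (∀ i, z i ≤ δ) → g z = 0 := by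
  let T : (ι → ℝ) → EuclideanSpace ℝ (Fin d) := fun z => ∑ k, z k • a k
  have hT : Continuous T := by fun_prop
  have hT_nonneg : ∀ z, 0 ≤ z → ∀ i, 0 ≤ T z i := fun z hz i => by
    simpa [T] using Finset.sum_nonneg fun k _ => mul_nonneg (hz k) (ha k i)
  obtain ⟨B, hB⟩ := exists_abs_polarLift_le hf hfc
  have hcont : Continuous fun z : ι → ℝ => polarLift f (T (z ⊔ 0)) :=
    (continuousOn_polarLift hf hfc).comp_continuous (hT.comp <| continuous_pi fun i =>
      (continuous_apply i).sup continuous_const) fun z => hT_nonneg _ le_sup_right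
  have hzero : ∀ᶠ z in 𝓝 0, polarLift f (T z) = 0 :=
    hT.tendsto' 0 0 (by simp [T]) (polarLift_eventuallyEq_zero hfc)
  obtain ⟨δ, hδ, hball⟩ := Metric.nhds_basis_closedBall.eventually_iff.mp hzero
  refine ⟨.ofNormedAddCommGroup _ hcont B fun z => hB _, δ, hδ, fun z hz => ?_, fun z hz => ?_⟩
  · simp only [BoundedContinuousFunction.coe_ofNormedAddCommGroup, sup_of_le_left hz, T]
  · refine hball (mem_closedBall_zero_iff.mpr ((pi_norm_le_iff_of_nonneg hδ.le).mpr fun i => ?_))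
    rw [Pi.sup_apply, Pi.zero_apply, Real.norm_of_nonneg le_sup_right]
    exact sup_le (hz i) hδ.le

variable {Ω : Type*} [MeasurableSpace Ω] {P : Measure Ω} {α : ℝ}

lemma IsStandardised.tendsto_mul_measureReal_map_Ioi {Y : Ω → ℝ} (h : IsStandardised P Y α)
    (hα : 0 < α) (hY : Measurable Y) {z : ℝ} (hz : 0 < z) :
    Tendsto (fun n : ℕ => (n : ℝ) * (P.map fun ω => (n : ℝ) ^ (-1 / α) * Y ω).real (Set.Ioi z))
      atTop (𝓝 ((powerDensity α).real (Set.Ioi z))) := by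
  rw [powerDensity_real_Ioi hα hz]
  refine (h z hz).congr fun n => ?_
  rw [map_measureReal_apply (by fun_prop) measurableSet_Ioi]
  rfl

variable [IsProbabilityMeasure P] {Y : ι → Ω → ℝ}

lemma tendsto_mul_integral_polarLift_sum (hα : 0 < α) (hY : ∀ k, Measurable (Y k))
    (hY_nonneg : ∀ k ω, 0 ≤ Y k ω) (hY_indep : iIndepFun Y P)
    (hY_std : ∀ k, IsStandardised P (Y k) α) {a : ι → EuclideanSpace ℝ (Fin d)}
    (ha : ∀ k i, 0 ≤ a k i) {f : PosRadii × posSphere d → ℝ} (hf : Continuous f)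
    (hfc : HasCompactSupport f) :
    Tendsto
      (fun n : ℕ => (n : ℝ) * ∫ ω, polarLift f (∑ k, ((n : ℝ) ^ (-1 / α) * Y k ω) • a k) ∂P)
      atTop (𝓝 (∑ k, ∫ t, polarLift f (t • a k) ∂(powerDensity α))) := by
  classical
  let W (n : ℕ) (k : ι) (ω : Ω) : ℝ := (n : ℝ) ^ (-1 / α) * Y k ω
  have hW : ∀ n k, Measurable (W n k) := fun n k => (hY k).const_mul _
  have hW_nonneg : ∀ n k ω, 0 ≤ W n k ω := fun n k ω =>
    mul_nonneg (Real.rpow_nonneg n.cast_nonneg _) (hY_nonneg k ω)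
  have hW_indep : ∀ n, iIndepFun (W n) P := fun n =>
    hY_indep.comp (fun _ y => (n : ℝ) ^ (-1 / α) * y) fun _ => measurable_const_mul _
  have hW_prob : ∀ n k, IsProbabilityMeasure (P.map (W n k)) := fun n k =>
    Measure.isProbabilityMeasure_map (hW n k).aemeasurable
  obtain ⟨g, δ, hδ, hg_eq, hg_zero⟩ := exists_boundedContinuousFunction_eq_polarLift_sum ha hf hfc
  have hlim := tendsto_mul_integral_pi (μ := fun n k => P.map (W n k))
    (ν := fun _ => powerDensity α)
    (fun n k => by
      rw [Measure.map_apply (hW n k) measurableSet_Iio]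
      exact measure_mono_null (fun ω hω => (hW_nonneg n k ω).not_gt hω) measure_empty)
    (fun _ z hz => by rw [powerDensity_Ioi hα hz]; exact ENNReal.ofReal_ne_top)
    (fun k z hz => (hY_std k).tendsto_mul_measureReal_map_Ioi hα (hY k) hz) hδ g hg_zero
  have haxis : ∀ k, ∫ t, g (Pi.single k t) ∂(powerDensity α) =
      ∫ t, polarLift f (t • a k) ∂(powerDensity α) := fun k => integral_congr_ae <| by
    filter_upwards [ae_powerDensity_pos α] with t ht
    rw [hg_eq _ (Pi.single_nonneg.mpr ht.le),
      Finset.sum_eq_single k (fun i _ hi => by rw [Pi.single_eq_of_ne hi, zero_smul]) (by simp),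
      Pi.single_eq_same]
  simp only [haxis] at hlim
  refine hlim.congr fun n => ?_
  rw [← (hW_indep n).map_fun_eq_pi_map fun k => (hW n k).aemeasurable,
    integral_map (by fun_prop) g.continuous.aestronglyMeasurable]
  simp only [hg_eq _ fun k => hW_nonneg n k _, W]

theorem isAngularMeasure_spectralMeasure (hα : 0 < α) (hY : ∀ k, Measurable (Y k))
    (hY_nonneg : ∀ k ω, 0 ≤ Y k ω) (hY_indep : iIndepFun Y P)
    (hY_std : ∀ k, IsStandardised P (Y k) α) (a : ι → puncturedOrthant d) :
    IsAngularMeasure P (fun ω => ∑ k, Y k ω • (a k : EuclideanSpace ℝ (Fin d))) α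
      (fun n => (n : ℝ) ^ (1 / α)) (spectralMeasure α a) := by
  refine ⟨inferInstance,
    (tendsto_rpow_atTop (one_div_pos.mpr hα)).comp tendsto_natCast_atTop_atTop, fun f => ?_⟩
  have hf : Continuous f := f.continuous
  rw [integral_prod_spectralMeasure hα a hf f.hasCompactSupport]
  refine (tendsto_mul_integral_polarLift_sum hα hY hY_nonneg hY_indep hY_std
    (fun k => (a k).2.1) hf f.hasCompactSupport).congr' ?_
  filter_upwards [eventually_gt_atTop 0] with n hn
  have hb : ((n : ℝ) ^ (1 / α))⁻¹ = (n : ℝ) ^ (-1 / α) := by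
    rw [neg_div, Real.rpow_neg n.cast_nonneg]
  rw [integral_smul_measure, integral_polarLaw P (by fun_prop)
    (Real.rpow_pos_of_pos (Nat.cast_pos.mpr hn) _) hf.measurable,
    ENNReal.toReal_natCast, smul_eq_mul]
  simp only [hb, Finset.smul_sum, smul_smul]

end LinearCombination

namespace LSEMPlus

variable {d : ℕ} (M : LSEMPlus d)

lemma wellFounded_adj : WellFounded M.graph.Adj := by
  have : IsTrans (Fin d) (Relation.TransGen M.graph.Adj) := ⟨fun _ _ _ => Relation.TransGen.trans⟩
  have : Std.Irrefl (Relation.TransGen M.graph.Adj) := ⟨M.acyclic⟩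
  exact Subrelation.wf (fun h => Relation.TransGen.single h)
    (Finite.wellFounded_of_trans_of_irrefl (Relation.TransGen M.graph.Adj))

lemma nonneg_of_eq_mulVec_add {v w : Fin d → ℝ} (hw : 0 ≤ w) (h : v = M.C.mulVec v + w) :
    0 ≤ v := by
  intro i
  induction i using M.wellFounded_adj.induction with
  | _ i ih =>
    rw [h, Pi.add_apply, Matrix.mulVec, dotProduct]
    refine add_nonneg (Finset.sum_nonneg fun j _ => ?_) (hw i)
    by_cases hj : M.graph.Adj j i
    · exact mul_nonneg (M.C_nonneg i j) (ih j hj)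
    · rw [M.C_eq_zero i j hj, zero_mul]

lemma isUnit_one_sub : IsUnit (1 - M.C) := by
  have hker : ∀ v : Fin d → ℝ, (1 - M.C).mulVec v = 0 → 0 ≤ v := fun v hv =>
    M.nonneg_of_eq_mulVec_add le_rfl <| by
      rwa [Matrix.sub_mulVec, Matrix.one_mulVec, sub_eq_zero, ← add_zero (M.C.mulVec v)] at hv
  rw [← Matrix.mulVec_injective_iff_isUnit]
  refine (injective_iff_map_eq_zero (1 - M.C).mulVecLin).mpr fun v hv => le_antisymm ?_ (hker v hv)
  rw [Matrix.mulVecLin_apply] at hv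
  exact neg_nonneg.mp (hker (-v) (by rw [Matrix.mulVec_neg, hv, neg_zero]))

lemma coeffMatrix_eq_mul_add : M.coeffMatrix = M.C * M.coeffMatrix + Matrix.diagonal M.s := by
  have h : (1 - M.C) * M.coeffMatrix = Matrix.diagonal M.s :=
    Matrix.mul_nonsing_inv_cancel_left _ _ ((Matrix.isUnit_iff_isUnit_det _).mp M.isUnit_one_sub)
  rw [← h, Matrix.sub_mul, Matrix.one_mul, add_sub_cancel]

lemma coeffMatrix_nonneg (i k : Fin d) : 0 ≤ M.coeffMatrix i k := by
  refine M.nonneg_of_eq_mulVec_add (v := M.coeffMatrix.col k) (w := (Matrix.diagonal M.s).col k)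
    (fun i => ?_) (congrArg (Matrix.col · k) M.coeffMatrix_eq_mul_add) i
  rw [Matrix.col_apply, Matrix.diagonal_apply]
  split_ifs
  exacts [(M.s_pos i).le, le_rfl]

lemma coeffMatrix_diag_pos (k : Fin d) : 0 < M.coeffMatrix k k := by
  rw [M.coeffMatrix_eq_mul_add, Matrix.add_apply, Matrix.mul_apply, Matrix.diagonal_apply_eq]
  exact add_pos_of_nonneg_of_pos
    (Finset.sum_nonneg fun j _ => mul_nonneg (M.C_nonneg k j) (M.coeffMatrix_nonneg j k))
    (M.s_pos k)

/-- The `k`-th column `a_k` of the innovation coefficient matrix, as a vector of the punctured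
orthant. -/
noncomputable def column (k : Fin d) : puncturedOrthant d :=
  ⟨columnVec M.coeffMatrix k, fun i => M.coeffMatrix_nonneg i k, fun h =>
    (M.coeffMatrix_diag_pos k).ne' (congrArg (fun v : EuclideanSpace ℝ (Fin d) => v k) h)⟩

variable {M} {Ω : Type*} {Z X : Ω → EuclideanSpace ℝ (Fin d)}

lemma IsSolution.eq_mulVec_add (hX : M.IsSolution Z X) (ω : Ω) :
    (X ω).ofLp = M.C.mulVec (X ω).ofLp + (Matrix.diagonal M.s).mulVec (Z ω).ofLp := by
  ext i
  rw [hX ω i, Pi.add_apply, Matrix.mulVec_diagonal]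
  congr 1
  refine Finset.sum_subset (Finset.subset_univ _) fun j _ hj => ?_
  rw [M.C_eq_zero i j fun hji => hj (by simpa [pa] using hji), zero_mul]

lemma IsSolution.nonneg (hX : M.IsSolution Z X) {ω : Ω} (hZ : ∀ i, 0 ≤ Z ω i) (i : Fin d) :
    0 ≤ X ω i :=
  M.nonneg_of_eq_mulVec_add
    (fun i => by simpa [Matrix.mulVec_diagonal] using mul_nonneg (M.s_pos i).le (hZ i))
    (hX.eq_mulVec_add ω) i

lemma IsSolution.eq_coeffMatrix_mulVec (hX : M.IsSolution Z X) (ω : Ω) :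
    X ω = WithLp.toLp 2 (M.coeffMatrix.mulVec (Z ω).ofLp) := by
  have h : (Matrix.diagonal M.s).mulVec (Z ω).ofLp = (1 - M.C).mulVec (X ω).ofLp := by
    rw [Matrix.sub_mulVec, Matrix.one_mulVec, eq_sub_iff_add_eq', ← hX.eq_mulVec_add]
  rw [coeffMatrix, ← Matrix.mulVec_mulVec, h, Matrix.mulVec_mulVec,
    Matrix.nonsing_inv_mul _ ((Matrix.isUnit_iff_isUnit_det _).mp M.isUnit_one_sub),
    Matrix.one_mulVec, WithLp.toLp_ofLp]

lemma IsSolution.eq_sum_column (hX : M.IsSolution Z X) :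
    X = fun ω => ∑ k, Z ω k • (M.column k : EuclideanSpace ℝ (Fin d)) := by
  ext ω i
  simp [hX.eq_coeffMatrix_mulVec ω, Matrix.mulVec, dotProduct, column, columnVec, mul_comm]

theorem IsSolution.isAngularMeasure_spectralMeasure [MeasurableSpace Ω] {P : Measure Ω}
    [IsProbabilityMeasure P] (hX : M.IsSolution Z X) (hZ : Measurable Z)
    (hZ_nonneg : ∀ ω i, 0 ≤ Z ω i) (hZ_indep : iIndepFun (fun i ω => Z ω i) P)
    (hZ_std : ∀ i, IsStandardised P (fun ω => Z ω i) 2) :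
    IsAngularMeasure P X 2 (fun n => √(n : ℝ)) (spectralMeasure 2 M.column) := by
  rw [hX.eq_sum_column]
  simp only [Real.sqrt_eq_rpow]
  exact _root_.isAngularMeasure_spectralMeasure two_pos (fun k => by fun_prop)
    (fun k ω => hZ_nonneg ω k) hZ_indep hZ_std M.column

end LSEMPlus

lemma IsRegularlyVarying.nonempty_fin {d : ℕ} {Ω : Type*} [MeasurableSpace Ω] {P : Measure Ω}
    {X : Ω → EuclideanSpace ℝ (Fin d)} {α : ℝ} (h : IsRegularlyVarying P X α) :
    Nonempty (Fin d) := by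
  obtain ⟨-, -, -, H, hH, -⟩ := h
  by_contra hd
  rw [not_nonempty_iff] at hd
  have : IsEmpty (posSphere d) := ⟨fun w =>
    (coe_posSphere_mem_puncturedOrthant w).2 (Subsingleton.elim _ _)⟩
  exact hH (Measure.eq_zero_of_isEmpty H)

theorem mainTheorem5 {d : ℕ} {Ω : Type*} [MeasurableSpace Ω] (P : Measure Ω)
    [IsProbabilityMeasure P] (M : LSEMPlus d)
    (Z X : Ω → EuclideanSpace ℝ (Fin d))
    (hZ_meas : Measurable Z)
    (hZ_rv : IsRegularlyVarying P Z 2)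
    (hZ_indep : iIndepFun (fun (i : Fin d) (ω : Ω) => Z ω i) P)
    (hZ_std : ∀ i, IsStandardised P (fun ω => Z ω i) 2)
    (hX : M.IsSolution Z X) :
    -- the representation `X = A Z` with `A` non-negative
    (∀ ω, X ω = WithLp.toLp 2 (M.coeffMatrix.mulVec (Z ω).ofLp)) ∧
    (∀ i j, 0 ≤ M.coeffMatrix i j) ∧
    -- `X` is regularly varying, and its angular measure for `b n = n ^ (1 / 2)` is well defined
    IsRegularlyVarying P X 2 ∧
    (∃! H : Measure (posSphere d), IsAngularMeasure P X 2 (fun n => √(n : ℝ)) H) ∧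
    ∀ H : Measure (posSphere d), IsAngularMeasure P X 2 (fun n => √(n : ℝ)) H →
      -- (i) the support of the angular measure
      (Subtype.val '' H.support =
        Set.range fun k => ‖columnVec M.coeffMatrix k‖⁻¹ • columnVec M.coeffMatrix k) ∧
      -- (ii) the extremal dependence measure
      (∀ i j, extremalDependence H i j = (M.coeffMatrix * M.coeffMatrix.transpose) i j ∧
        extremalDependence H i j = ∑ k, M.coeffMatrix i k * M.coeffMatrix j k) ∧
      -- (iii) the squared scalings
      (∀ i, scaling H i ^ 2 = ∑ k, M.coeffMatrix i k ^ 2) := by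
  have := hZ_rv.nonempty_fin
  have hang := hX.isAngularMeasure_spectralMeasure hZ_meas hZ_rv.2.1 hZ_indep hZ_std
  refine ⟨hX.eq_coeffMatrix_mulVec, M.coeffMatrix_nonneg,
    ⟨two_pos, fun ω => hX.nonneg (hZ_rv.2.1 ω), _, _, spectralMeasure_ne_zero 2 M.column, hang⟩,
    ⟨_, hang, fun H hH => hH.unique two_pos hang⟩, fun H hH => ?_⟩
  obtain rfl : H = spectralMeasure 2 M.column := hH.unique two_pos hang
  have hmoment : ∀ i j, extremalDependence (spectralMeasure 2 M.column) i j =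
      ∑ k, M.coeffMatrix i k * M.coeffMatrix j k :=
    extremalDependence_spectralMeasure_two M.column
  refine ⟨?_, fun i j => ⟨hmoment i j, hmoment i j⟩, fun i => ?_⟩
  · rw [support_spectralMeasure, ← Set.range_comp]
    rfl
  · rw [scaling, hmoment, Real.sq_sqrt (Finset.sum_nonneg fun k _ => mul_self_nonneg _)]
    simp only [sq]
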